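/- Compactness theorem for first-order rational Gödel logic $RGL^*$. Let $\mathbb{I}=[0,1]^2\setminus\{(0,r):r>0\}$ with the lexicographic order (a complete linear order), and write $\hat r=(r,r)$ for $r\in[0,1]\cap\mathbb{Q}$. Let $\mathcal{L}$ be a first-order language with (at most) countably many predicate, function and constant symbols. The $\mathcal{L}$-formulas of $RGL^*$ are built, with countably many variables, from atomic formulas $P(t_1,\dots,t_n)$ and the nullary connectives $\bar r$ ($r\in[0,1]\cap\mathbb{Q}$) by $\wedge,\to,\forall,\exists$, where $\neg\varphi:=\varphi\to\bar 1$ and $\varphi\vee\psi:=((\varphi\to\psi)\to\psi)\wedge((\psi\to\varphi)\to\varphi)$. A sentence is a formula without free variables, and an $\mathcal{L}$-theory is any set of $\mathcal{L}$-sentences. An $\mathcal{L}$-structure $\mathcal{M}$ is a nonempty set $M$ with a function $f^{\mathcal{M}}:M^n\to M$ for each $n$-ary function symbol $f$, an element $c^{\mathcal{M}}\in M$ for each constant symbol $c$, and a function $P^{\mathcal{M}}:M^n\to\mathbb{I}$ for each $n$-ary predicate symbol $P$. Terms are interpreted as usual, and the value $\varphi^{\mathcal{M},\sigma}\in\mathbb{I}$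 of a formula under an assignment $\sigma$ of elements of $M$ to the variables is given by $\bar r^{\mathcal{M},\sigma}=\hat r$; $P(t_1,\dots,t_n)^{\mathcal{M},\sigma}=P^{\mathcal{M}}(t_1^{\mathcal{M},\sigma},\dots,t_n^{\mathcal{M},\sigma})$; $(\varphi\wedge\psi)^{\mathcal{M},\sigma}=\max\{\varphi^{\mathcal{M},\sigma},\psi^{\mathcal{M},\sigma}\}$; $(\varphi\to\psi)^{\mathcal{M},\sigma}=\hat 0$ if $\varphi^{\mathcal{M},\sigma}\ge\psi^{\mathcal{M},\sigma}$, and $\psi^{\mathcal{M},\sigma}$ otherwise; and $(\forall x\,\varphi)^{\mathcal{M},\sigma}$, $(\exists x\,\varphi)^{\mathcal{M},\sigma}$ are respectively the supremum and the infimum in $\mathbb{I}$ of $\varphi^{\mathcal{M},\sigma'}$ over all assignments $\sigma'$ that agree with $\sigma$ except possibly at $x$. Thus $\hat 0$ is absolute truth. A theory $T$ is satisfiable if there is an $\mathcal{L}$-structure $\mathcal{M}$ in which every sentence of $T$ has value $\hat 0$, and finitely satisfiable if every finite subset of $T$ is satisfiable. Then every finitely satisfiable $\mathcal{L}$-theory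 is satisfiable. -/

import Mathlib

universe u v w

namespace RGL

/-- The set of truth values `[0,1]² ∖ {(0,r) : r > 0}`, ordered lexicographically
(the order is the one inherited from `ℝ ×ₗ ℝ`). -/
abbrev TruthValue : Type :=
  {p : ℝ ×ₗ ℝ // (ofLex p).1 ∈ Set.Icc (0 : ℝ) 1 ∧ (ofLex p).2 ∈ Set.Icc (0 : ℝ) 1 ∧
    ¬ ((ofLex p).1 = 0 ∧ 0 < (ofLex p).2)}

/-- The set `[0,1] ∩ ℚ` indexing the nullary connectives. -/
abbrev RatUnit : Type := {r : ℚ // 0 ≤ r ∧ r ≤ 1}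

/-- The truth value `r̂ = (r, r)`. -/
def hat (r : RatUnit) : TruthValue :=
  ⟨toLex ((r.1 : ℝ), (r.1 : ℝ)), by
    have h0 : (0 : ℝ) ≤ (r.1 : ℝ) := by exact_mod_cast r.2.1
    have h1 : (r.1 : ℝ) ≤ 1 := by exact_mod_cast r.2.2
    refine ⟨⟨h0, h1⟩, ⟨h0, h1⟩, ?_⟩
    rintro ⟨h, h'⟩
    exact absurd h h'.ne'⟩

/-- The rational number `0`, indexing the connective for absolute truth. -/
def zeroRat : RatUnit := ⟨0, le_refl 0, zero_le_one⟩

/-- The rational number `1`, indexing the connective for absolute falsity. -/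
def oneRat : RatUnit := ⟨1, zero_le_one, le_refl 1⟩

theorem TruthValue.exists_isLUB (S : Set TruthValue) : ∃ a, IsLUB S a := by
  have hle : ∀ p q : TruthValue, p ≤ q ↔ (ofLex p.1).1 < (ofLex q.1).1 ∨
      (ofLex p.1).1 = (ofLex q.1).1 ∧ (ofLex p.1).2 ≤ (ofLex q.1).2 := fun p q =>
    Prod.Lex.le_iff (x := p.1) (y := q.1)
  have hsnd : ∀ p : TruthValue, (ofLex p.1).1 = 0 → (ofLex p.1).2 = 0 := fun p hp =>
    le_antisymm (not_lt.1 fun h => p.2.2.2 ⟨hp, h⟩) p.2.2.1.1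
  rcases S.eq_empty_or_nonempty with rfl | ⟨s₀, hs₀⟩
  · refine ⟨hat zeroRat, by simp, fun q _ => ?_⟩
    rw [hle]
    rcases q.2.1.1.eq_or_lt with h | h
    · right
      simp [hat, zeroRat, ← h, q.2.2.1.1]
    · left
      simpa [hat, zeroRat] using h
  · set A : Set ℝ := (fun p : TruthValue => (ofLex p.1).1) '' S with hA
    have hAne : A.Nonempty := ⟨_, s₀, hs₀, rfl⟩
    have hAb : BddAbove A := ⟨1, by rintro _ ⟨p, -, rfl⟩; exact p.2.1.2⟩
    have ha := isLUB_csSup hAne hAb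
    set a := sSup A
    have ha1 : a ≤ 1 := ha.2 (by rintro _ ⟨p, -, rfl⟩; exact p.2.1.2)
    have ha0 : 0 ≤ a := s₀.2.1.1.trans (ha.1 ⟨s₀, hs₀, rfl⟩)
    by_cases hatt : ∃ p ∈ S, (ofLex p.1).1 = a
    · obtain ⟨p₀, hp₀, hp₀a⟩ := hatt
      set B : Set ℝ := (fun p : TruthValue => (ofLex p.1).2) '' {p ∈ S | (ofLex p.1).1 = a}
      have hBne : B.Nonempty := ⟨_, p₀, ⟨hp₀, hp₀a⟩, rfl⟩
      have hBb : BddAbove B := ⟨1, by rintro _ ⟨p, -, rfl⟩; exact p.2.2.1.2⟩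
      have hb := isLUB_csSup hBne hBb
      set b := sSup B
      have hb1 : b ≤ 1 := hb.2 (by rintro _ ⟨p, -, rfl⟩; exact p.2.2.1.2)
      have hb0 : 0 ≤ b := p₀.2.2.1.1.trans (hb.1 ⟨p₀, ⟨hp₀, hp₀a⟩, rfl⟩)
      refine ⟨⟨toLex (a, b), ⟨ha0, ha1⟩, ⟨hb0, hb1⟩, ?_⟩, ?_, ?_⟩
      · rintro ⟨h0, hpos⟩
        refine absurd hpos (not_lt.2 (hb.2 ?_))
        rintro _ ⟨p, ⟨-, hp⟩, rfl⟩
        exact (hsnd p (hp.trans h0)).le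
      · intro p hp
        rw [hle]
        rcases (ha.1 ⟨p, hp, rfl⟩ : (ofLex p.1).1 ≤ a).lt_or_eq with h | h
        · exact Or.inl h
        · exact Or.inr ⟨h, hb.1 ⟨p, ⟨hp, h⟩, rfl⟩⟩
      · intro q hq
        rw [hle]
        have haq : a ≤ (ofLex q.1).1 := by
          rcases (hle _ _).1 (hq hp₀) with h | h
          · exact hp₀a ▸ h.le
          · exact hp₀a ▸ h.1.le
        rcases haq.lt_or_eq with h | h
        · exact Or.inl h
        · refine Or.inr ⟨h, hb.2 ?_⟩
          rintro _ ⟨p, ⟨hp, hpa⟩, rfl⟩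
          rcases (hle _ _).1 (hq hp) with h' | h'
          · exact absurd (hpa.trans h) h'.ne
          · exact h'.2
    · push Not at hatt
      refine ⟨⟨toLex (a, 0), ⟨ha0, ha1⟩, ⟨le_refl 0, zero_le_one⟩, fun h => lt_irrefl _ h.2⟩,
        ?_, ?_⟩
      · intro p hp
        rw [hle]
        exact Or.inl (lt_of_le_of_ne (ha.1 ⟨p, hp, rfl⟩) (hatt p hp))
      · intro q hq
        rw [hle]
        have haq : a ≤ (ofLex q.1).1 := by
          refine ha.2 ?_
          rintro _ ⟨p, hp, rfl⟩
          rcases (hle _ _).1 (hq hp) with h | h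
          · exact h.le
          · exact h.1.le
        rcases haq.lt_or_eq with h | h
        · exact Or.inl h
        · exact Or.inr ⟨h, q.2.2.1.1⟩

theorem TruthValue.exists_isGLB (S : Set TruthValue) : ∃ a, IsGLB S a :=
  (TruthValue.exists_isLUB (lowerBounds S)).imp fun _ h => isLUB_lowerBounds.1 h

/-- The least upper bound of a set of truth values. -/
noncomputable def TruthValue.sup (S : Set TruthValue) : TruthValue :=
  (TruthValue.exists_isLUB S).choose

/-- The greatest lower bound of a set of truth values. -/
noncomputable def TruthValue.inf (S : Set TruthValue) : TruthValue :=
  (TruthValue.exists_isGLB S).choose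

theorem TruthValue.isLUB_sup (S : Set TruthValue) : IsLUB S (TruthValue.sup S) :=
  (TruthValue.exists_isLUB S).choose_spec

theorem TruthValue.isGLB_inf (S : Set TruthValue) : IsGLB S (TruthValue.inf S) :=
  (TruthValue.exists_isGLB S).choose_spec

/-- The truth function of implication (`0̂` is absolute truth). -/
noncomputable def TruthValue.imp (a b : TruthValue) : TruthValue :=
  if b ≤ a then hat zeroRat else b

/-- Formulas of first-order rational Gödel logic over `L`, with variables indexed by `ℕ`. The
function symbols of arity `0` of `L` are its constant symbols. -/
inductive Formula (L : FirstOrder.Language.{u, v}) : Type (max u v)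
  | const (r : RatUnit) : Formula L
  | atom {n : ℕ} (P : L.Relations n) (t : Fin n → L.Term ℕ) : Formula L
  | and (φ ψ : Formula L) : Formula L
  | imp (φ ψ : Formula L) : Formula L
  | all (x : ℕ) (φ : Formula L) : Formula L
  | ex (x : ℕ) (φ : Formula L) : Formula L

/-- `¬φ := φ → 1̄`. -/
def Formula.neg {L : FirstOrder.Language.{u, v}} (φ : Formula L) : Formula L :=
  .imp φ (.const oneRat)

/-- `φ ∨ ψ := ((φ → ψ) → ψ) ∧ ((ψ → φ) → φ)`. -/
def Formula.or {L : FirstOrder.Language.{u, v}} (φ ψ : Formula L) : Formula L :=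
  .and (.imp (.imp φ ψ) ψ) (.imp (.imp ψ φ) φ)

/-- The set of variables occurring in a term. -/
def termVars {L : FirstOrder.Language.{u, v}} : L.Term ℕ → Set ℕ
  | .var x => {x}
  | .func _ t => ⋃ i, termVars (t i)

/-- The set of free variables of a formula. -/
def Formula.freeVars {L : FirstOrder.Language.{u, v}} : Formula L → Set ℕ
  | .const _ => ∅
  | .atom _ t => ⋃ i, termVars (t i)
  | .and φ ψ => φ.freeVars ∪ ψ.freeVars
  | .imp φ ψ => φ.freeVars ∪ ψ.freeVars
  | .all x φ => φ.freeVars \ {x}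
  | .ex x φ => φ.freeVars \ {x}

/-- Sentences: formulas without free variables. -/
abbrev Sentence (L : FirstOrder.Language.{u, v}) : Type (max u v) :=
  {φ : Formula L // φ.freeVars = ∅}

/-- Theories: arbitrary sets of sentences. -/
abbrev Theory (L : FirstOrder.Language.{u, v}) : Type (max u v) := Set (Sentence L)

/-- Structures: a nonempty universe, with a function `Mⁿ → M` for each `n`-ary function symbol
(an element of `M` for each constant symbol), and a function from `Mⁿ` to the truth values for
each `n`-ary predicate symbol. -/
structure Model (L : FirstOrder.Language.{u, v}) : Type (max u v (w + 1)) where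
  carrier : Type w
  nonempty : Nonempty carrier
  funMap : ∀ {n : ℕ}, L.Functions n → (Fin n → carrier) → carrier
  predMap : ∀ {n : ℕ}, L.Relations n → (Fin n → carrier) → TruthValue

variable {L : FirstOrder.Language.{u, v}}

/-- The interpretation of a term under an assignment. -/
def Model.termVal (M : Model.{u, v, w} L) (σ : ℕ → M.carrier) : L.Term ℕ → M.carrier
  | .var x => σ x
  | .func f t => M.funMap f fun i => M.termVal σ (t i)

/-- The interpretation of a formula under an assignment. -/
noncomputable def Model.val (M : Model.{u, v, w} L) :
    Formula L → (ℕ → M.carrier) → TruthValue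
  | .const r, _ => hat r
  | .atom P t, σ => M.predMap P fun i => M.termVal σ (t i)
  | .and φ ψ, σ => max (M.val φ σ) (M.val ψ σ)
  | .imp φ ψ, σ => TruthValue.imp (M.val φ σ) (M.val ψ σ)
  | .all x φ, σ => TruthValue.sup (Set.range fun a => M.val φ (Function.update σ x a))
  | .ex x φ, σ => TruthValue.inf (Set.range fun a => M.val φ (Function.update σ x a))

/-- `M ⊨ φ`: the truth value of the sentence `φ` (under any assignment) is `0̂`. -/
def Model.Satisfies (M : Model.{u, v, w} L) (φ : Sentence L) : Prop :=
  ∀ σ : ℕ → M.carrier, M.val φ.1 σ = hat zeroRat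

/-- A theory is satisfiable if some structure satisfies all of its sentences. -/
def Theory.Satisfiable (T : Theory L) : Prop :=
  ∃ M : Model.{u, v, w} L, ∀ φ ∈ T, M.Satisfies φ

/-- A theory is finitely satisfiable if all of its finite subsets are satisfiable. -/
def Theory.FinitelySatisfiable (T : Theory L) : Prop :=
  ∀ S : Theory L, S ⊆ T → S.Finite → Theory.Satisfiable.{u, v, w} S

end RGL

/-! Let `M n` satisfy the members of the theory enumerated up to `n`, and evaluate formulas in the
ultrapower of the truth values along a nonprincipal ultrafilter. The order and the connectives pass
to germs, but germs are not truth values. Two steps turn them into a structure.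

A Löwenheim–Skolem argument (`exists_countable_witnesses`) selects a countable part of the product,
closed under the functions and containing quantifier witnesses. A witness has the same standard
first coordinate as the quantified value, and it separates that value from any given formula value
on the relevant side. Hence quantifiers are suprema and infima within the countable order `D` of
attained values.

Then `exists_map_truthValue` sends `D` to the truth values. The fibre over a standard part `t > 0`
goes into `{t} × [0,1]`, preserving suprema and infima (`exists_strictMono_isLUB_isGLB`) and placing
each rational constant at `(r, r)`. The fibre over `0` collapses to `0̂`; this respects implication,
because an implication whose two sides are merged has value `0̂` either way. Bounds over the whole
of `D` survive because some witness lies in the fibre of the bound. -/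

open Filter Topology

namespace RGL

/-! ### Embedding countable linear orders into the reals -/

/-- The points of `D` that are not limits of strictly larger points. -/
def IsJump {D : Type*} [LinearOrder D] (d : D) : Prop := IsMax d ∨ ∃ e, d ⋖ e

/-- The linear order obtained from `D` by filling every jump, and both ends, with rationals. -/
abbrev JumpFilling (D : Type*) [LinearOrder D] : Type _ :=
  {p : D ×ₗ ℚ // (0 < (ofLex p).2 → IsJump (ofLex p).1) ∧ ((ofLex p).2 < 0 → IsMin (ofLex p).1)}

namespace JumpFilling

variable {D : Type*} [LinearOrder D]

theorem lt_iff {p q : JumpFilling D} : p < q ↔ (ofLex p.1).1 < (ofLex q.1).1 ∨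
    (ofLex p.1).1 = (ofLex q.1).1 ∧ (ofLex p.1).2 < (ofLex q.1).2 :=
  Prod.Lex.lt_iff (x := p.1) (y := q.1)

/-- The inclusion of `D` into its jump filling. -/
def of (d : D) : JumpFilling D :=
  ⟨toLex (d, 0), fun h => absurd h (lt_irrefl _), fun h => absurd h (lt_irrefl _)⟩

theorem of_lt_of {d e : D} : of d < of e ↔ d < e := by
  refine lt_iff.trans ?_
  simp [of]

instance [Countable D] : Countable (JumpFilling D) :=
  have : Countable (D ×ₗ ℚ) := inferInstanceAs (Countable (D × ℚ))
  inferInstance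

instance : NoMinOrder (JumpFilling D) where
  exists_lt := by
    rintro ⟨p, h1, h2⟩
    by_cases hm : IsMin (ofLex p).1
    · refine ⟨⟨toLex ((ofLex p).1, min (ofLex p).2 0 - 1), fun h => ?_, fun _ => hm⟩,
        lt_iff.2 (Or.inr ⟨rfl, ?_⟩)⟩
      · have h' : 0 < min (ofLex p).2 0 - 1 := h
        linarith [min_le_right (ofLex p).2 0]
      · change min (ofLex p).2 0 - 1 < (ofLex p).2
        linarith [min_le_left (ofLex p).2 0]
    · obtain ⟨e, he⟩ := not_isMin_iff.1 hm
      exact ⟨of e, lt_iff.2 (Or.inl he)⟩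

instance : NoMaxOrder (JumpFilling D) where
  exists_gt := by
    rintro ⟨p, h1, h2⟩
    by_cases hm : IsMax (ofLex p).1
    · refine ⟨⟨toLex ((ofLex p).1, max (ofLex p).2 0 + 1), fun _ => Or.inl hm, fun h => ?_⟩,
        lt_iff.2 (Or.inr ⟨rfl, ?_⟩)⟩
      · have h' : max (ofLex p).2 0 + 1 < 0 := h
        linarith [le_max_right (ofLex p).2 0]
      · change (ofLex p).2 < max (ofLex p).2 0 + 1
        linarith [le_max_left (ofLex p).2 0]
    · obtain ⟨e, he⟩ := not_isMax_iff.1 hm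
      exact ⟨of e, lt_iff.2 (Or.inl he)⟩

/-- Above a jump the inserted rationals separate it from later points; a point that is not a jump
has no successor, so `D` itself supplies a point between. -/
instance : DenselyOrdered (JumpFilling D) where
  dense := by
    rintro ⟨p, hp1, hp2⟩ ⟨q, hq1, hq2⟩ hpq
    rcases lt_iff.1 hpq with h | ⟨h, h'⟩
    · change (ofLex p).1 < (ofLex q).1 at h
      by_cases hj : IsJump (ofLex p).1
      · refine ⟨⟨toLex ((ofLex p).1, max (ofLex p).2 0 + 1), fun _ => hj, fun h => ?_⟩,
          lt_iff.2 (Or.inr ⟨rfl, ?_⟩), lt_iff.2 (Or.inl h)⟩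
        · have h' : max (ofLex p).2 0 + 1 < 0 := h
          linarith [le_max_right (ofLex p).2 0]
        · change (ofLex p).2 < max (ofLex p).2 0 + 1
          linarith [le_max_left (ofLex p).2 0]
      · have : ¬ (ofLex p).1 ⋖ (ofLex q).1 := fun hc => hj (Or.inr ⟨_, hc⟩)
        obtain ⟨c, hc1, hc2⟩ := (not_covBy_iff h).1 this
        exact ⟨of c, lt_iff.2 (Or.inl hc1), lt_iff.2 (Or.inl hc2)⟩
    · change (ofLex p).1 = (ofLex q).1 at h
      change (ofLex p).2 < (ofLex q).2 at h'
      obtain ⟨r, hr1, hr2⟩ := exists_between h'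
      exact ⟨⟨toLex ((ofLex p).1, r), fun hr => h ▸ hq1 (lt_trans hr hr2),
        fun hr => hp2 (lt_trans hr1 hr)⟩, lt_iff.2 (Or.inr ⟨rfl, hr1⟩), lt_iff.2 (Or.inr ⟨h, hr2⟩)⟩

end JumpFilling

/-- A countable linear order embeds into the reals so that all existing suprema and infima of
nonempty sets are preserved. -/
theorem exists_strictMono_isLUB_isGLB (D : Type*) [LinearOrder D] [Countable D] :
    ∃ j : D → ℝ, StrictMono j ∧
      (∀ S : Set D, ∀ d, S.Nonempty → IsLUB S d → IsLUB (j '' S) (j d)) ∧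
      (∀ S : Set D, ∀ d, S.Nonempty → IsGLB S d → IsGLB (j '' S) (j d)) := by
  rcases isEmpty_or_nonempty D with hD | ⟨⟨d₀⟩⟩
  · exact ⟨fun _ => 0, fun a => hD.elim a, fun _ d => hD.elim d, fun _ d => hD.elim d⟩
  have : Nonempty (JumpFilling D) := ⟨JumpFilling.of d₀⟩
  obtain ⟨f⟩ := Order.iso_of_countable_dense (JumpFilling D) ℚ
  have hmono : StrictMono fun d => ((f (JumpFilling.of d) : ℚ) : ℝ) := fun a b hab =>
    Rat.cast_lt.2 (f.lt_iff_lt.2 (JumpFilling.of_lt_of.2 hab))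
  refine ⟨_, hmono, fun S d hS h => ⟨hmono.monotone.mem_upperBounds_image h.1, fun y hy => ?_⟩,
    fun S d hS h => ⟨hmono.monotone.mem_lowerBounds_image h.1, fun y hy => ?_⟩⟩
  · by_contra! hlt
    obtain ⟨q, hyq, hqd⟩ := exists_rat_btwn hlt
    obtain ⟨p, rfl⟩ := f.surjective q
    -- The rational between `y` and the image of `d` is a point `p` of the filling; an element of
    -- `S` beyond `p` contradicts the bound `y`.
    have key : ∃ s ∈ S, p < JumpFilling.of s := by
      rcases JumpFilling.lt_iff.1 (f.lt_iff_lt.1 (Rat.cast_lt.1 hqd)) with hp | ⟨hp, hp0⟩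
      · obtain ⟨s, hs, hps, -⟩ := h.exists_between hp
        exact ⟨s, hs, JumpFilling.lt_iff.2 (Or.inl hps)⟩
      · obtain ⟨s, hs⟩ := hS
        -- Points are inserted directly below `d` only if `d` is minimal, and then `S = {d}`. An
        -- empty `S` would break this case.
        have hmin := p.2.2 hp0
        rw [hp] at hmin
        have hsd : s = d := hmin.eq_of_le (h.1 hs)
        exact ⟨s, hs, JumpFilling.lt_iff.2 (Or.inr ⟨hsd ▸ hp, hp0⟩)⟩
    obtain ⟨s, hs, hps⟩ := key
    have h1 := hy ⟨s, hs, rfl⟩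
    have h2 : ((f p : ℚ) : ℝ) < (f (JumpFilling.of s) : ℚ) := Rat.cast_lt.2 (f.lt_iff_lt.2 hps)
    exact absurd (hyq.trans h2) (not_lt.2 h1)
  · by_contra! hlt
    obtain ⟨q, hqd, hyq⟩ := exists_rat_btwn hlt
    obtain ⟨p, rfl⟩ := f.surjective q
    have key : ∃ s ∈ S, JumpFilling.of s < p := by
      rcases JumpFilling.lt_iff.1 (f.lt_iff_lt.1 (Rat.cast_lt.1 hqd)) with hp | ⟨hp, hp0⟩
      · obtain ⟨s, hs, -, hps⟩ := h.exists_between hp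
        exact ⟨s, hs, JumpFilling.lt_iff.2 (Or.inl hps)⟩
      · have hd : d ∈ S := by
          have hj := p.2.1 hp0
          rw [← hp] at hj
          rcases hj with hmax | ⟨e, he⟩
          · obtain ⟨s, hs⟩ := hS
            have hsd : s = d := hmax.eq_of_ge (h.1 hs)
            exact hsd ▸ hs
          · obtain ⟨s, hs, hds, hse⟩ := h.exists_between he.lt
            rcases hds.eq_or_lt with h' | h'
            · exact h'.symm ▸ hs
            · exact absurd hse (he.2 h')
        exact ⟨d, hd, JumpFilling.lt_iff.2 (Or.inr ⟨hp, hp0⟩)⟩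
    obtain ⟨s, hs, hps⟩ := key
    have h1 := hy ⟨s, hs, rfl⟩
    have h2 : ((f (JumpFilling.of s) : ℚ) : ℝ) < (f p : ℚ) := Rat.cast_lt.2 (f.lt_iff_lt.2 hps)
    exact absurd (h2.trans hyq) (not_lt.2 h1)

/-- The embedding can be chosen into `[0,1]`, with a prescribed value `t > 0` at a given point
`p`, where `p` has to be the largest element if `t = 1`. -/
theorem exists_strictMono_unitInterval {D : Type*} [LinearOrder D] [Countable D] {t : ℝ}
    (ht0 : 0 < t) (ht1 : t ≤ 1) (p : D) (hp : t = 1 → ∀ d, d ≤ p) :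
    ∃ j : D → ℝ, StrictMono j ∧ (∀ d, j d ∈ Set.Icc (0 : ℝ) 1) ∧ j p = t ∧
      (∀ S : Set D, ∀ d, S.Nonempty → IsLUB S d → IsLUB (j '' S) (j d)) ∧
      (∀ S : Set D, ∀ d, S.Nonempty → IsGLB S d → IsGLB (j '' S) (j d)) := by
  obtain ⟨j, hj, hsup, hinf⟩ := exists_strictMono_isLUB_isGLB D
  -- A continuous monotone map taking `j p` to `t`, the left half-line into `(0,t]` and the right
  -- one into `[t,1]`. For `t = 1` it is constant to the right of `j p`, so `p` must then be
  -- largest.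
  let k : ℝ → ℝ := fun x =>
    t * Real.exp (min (x - j p) 0) + (1 - t) * (1 - Real.exp (- max (x - j p) 0))
  have hcont : Continuous k := by fun_prop
  have ht : 0 ≤ 1 - t := by linarith
  have hmono : Monotone k := by
    intro x y hxy
    simp only [k]
    gcongr
  refine ⟨fun d => k (j d), fun a b hab => ?_, fun d => ⟨?_, ?_⟩, ?_, fun S d hS h => ?_,
    fun S d hS h => ?_⟩
  · have hab' := hj hab
    simp only [k]
    rcases le_or_gt (j b) (j p) with hb | hb
    · refine add_lt_add_of_lt_of_le ?_ (by gcongr)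
      rw [min_eq_left (by linarith), min_eq_left (by linarith)]
      gcongr
    · have ht' : 0 < 1 - t := by
        refine lt_of_le_of_ne ht fun h => ?_
        exact absurd (hj.monotone (hp (by linarith) b)) (not_le.2 hb)
      refine add_lt_add_of_le_of_lt (by gcongr) ?_
      have : max (j a - j p) 0 < max (j b - j p) 0 := by
        rw [max_eq_left (a := j b - j p) (by linarith)]
        exact max_lt (by linarith) (by linarith)
      gcongr
  · have : Real.exp (- max (j d - j p) 0) ≤ 1 := Real.exp_le_one_iff.2 (by simp)
    have h2 := mul_nonneg ht (sub_nonneg.2 this)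
    have := Real.exp_pos (min (j d - j p) 0)
    positivity
  · have h1 : Real.exp (min (j d - j p) 0) ≤ 1 := Real.exp_le_one_iff.2 (by simp)
    have h2 := Real.exp_pos (- max (j d - j p) 0)
    simp only [k]
    nlinarith
  · simp [k]
  · rw [← Set.image_image]
    exact (hsup S d hS h).isLUB_of_tendsto (hmono.monotoneOn _) (hS.image _)
      (hcont.continuousAt.tendsto.mono_left nhdsWithin_le_nhds)
  · rw [← Set.image_image]
    exact (hinf S d hS h).isGLB_of_tendsto (hmono.monotoneOn _) (hS.image _)
      (hcont.continuousAt.tendsto.mono_left nhdsWithin_le_nhds)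

/-! ### Truth values -/

namespace TruthValue

/-- The first coordinate of a truth value. -/
def fst (p : TruthValue) : ℝ := (ofLex p.1).1

/-- The second coordinate of a truth value. -/
def snd (p : TruthValue) : ℝ := (ofLex p.1).2

theorem le_iff {p q : TruthValue} : p ≤ q ↔ p.fst < q.fst ∨ p.fst = q.fst ∧ p.snd ≤ q.snd :=
  Prod.Lex.le_iff (x := p.1) (y := q.1)

theorem fst_mono : Monotone fst := fun _ _ h => by
  rcases le_iff.1 h with h | h
  · exact h.le
  · exact h.1.le

theorem fst_mem (p : TruthValue) : p.fst ∈ Set.Icc (0 : ℝ) 1 := p.2.1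

theorem snd_mem (p : TruthValue) : p.snd ∈ Set.Icc (0 : ℝ) 1 := p.2.2.1

theorem ext {p q : TruthValue} (h1 : p.fst = q.fst) (h2 : p.snd = q.snd) : p = q :=
  le_antisymm (le_iff.2 (Or.inr ⟨h1, h2.le⟩)) (le_iff.2 (Or.inr ⟨h1.symm, h2.ge⟩))

/-- The truth value with given coordinates, the first one being positive. -/
def mk (a b : ℝ) (ha : 0 < a) (ha1 : a ≤ 1) (hb : b ∈ Set.Icc (0 : ℝ) 1) : TruthValue :=
  ⟨toLex (a, b), ⟨ha.le, ha1⟩, hb, fun h => ha.ne' h.1⟩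

@[simp] theorem fst_mk (a b : ℝ) (ha ha1 hb) : (mk a b ha ha1 hb).fst = a := rfl

@[simp] theorem snd_mk (a b : ℝ) (ha ha1 hb) : (mk a b ha ha1 hb).snd = b := rfl

@[simp] theorem fst_hat (r : RatUnit) : (hat r).fst = r.1 := rfl

@[simp] theorem snd_hat (r : RatUnit) : (hat r).snd = r.1 := rfl

theorem hat_zero_le (p : TruthValue) : hat zeroRat ≤ p := by
  rw [le_iff]
  rcases p.fst_mem.1.eq_or_lt with h | h
  · right
    simpa [zeroRat, ← h] using p.snd_mem.1
  · left
    simpa [zeroRat] using h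

theorem le_hat_one (p : TruthValue) : p ≤ hat oneRat := by
  rw [le_iff]
  rcases p.fst_mem.2.eq_or_lt with h | h
  · right
    simpa [oneRat, h] using p.snd_mem.2
  · left
    simpa [oneRat] using h

/-- A supremum is approached by elements with almost the same first coordinate. -/
theorem exists_mem_near_isLUB {S : Set TruthValue} {v : TruthValue} (hS : S.Nonempty)
    (hv : IsLUB S v) {ε : ℝ} (hε : 0 < ε) (d : TruthValue) :
    ∃ s ∈ S, v.fst - ε < s.fst ∧ (d < v → d < s) := by
  have h1 : ∃ s ∈ S, v.fst - ε < s.fst := by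
    by_contra! h
    obtain ⟨s, hs⟩ := hS
    -- Otherwise `(v.fst - ε/2, 1)` would be an upper bound strictly below `v`.
    have hpos : 0 < v.fst - ε / 2 := by linarith [h s hs, s.fst_mem.1]
    have hle : v ≤ mk (v.fst - ε / 2) 1 hpos (by linarith [v.fst_mem.2]) (by simp) :=
      hv.2 fun a ha => le_iff.2 (Or.inl (by rw [fst_mk]; linarith [h a ha]))
    have := fst_mono hle
    rw [fst_mk] at this
    linarith
  obtain ⟨s, hs, hsε⟩ := h1
  by_cases hd : d < v
  · obtain ⟨s', hs', hds', -⟩ := hv.exists_between hd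
    -- The larger of the two witnesses meets both requirements.
    rcases le_total s s' with h | h
    · exact ⟨s', hs', hsε.trans_le (fst_mono h), fun _ => hds'⟩
    · exact ⟨s, hs, hsε, fun _ => hds'.trans_le h⟩
  · exact ⟨s, hs, hsε, fun h => absurd h hd⟩

/-- An infimum is approached by elements with almost the same first coordinate. -/
theorem exists_mem_near_isGLB {S : Set TruthValue} {v : TruthValue} (hS : S.Nonempty)
    (hv : IsGLB S v) {ε : ℝ} (hε : 0 < ε) (d : TruthValue) :
    ∃ s ∈ S, s.fst < v.fst + ε ∧ (v < d → s < d) := by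
  have h1 : ∃ s ∈ S, s.fst < v.fst + ε := by
    by_contra! h
    obtain ⟨s, hs⟩ := hS
    have hpos : 0 < v.fst + ε / 2 := by linarith [v.fst_mem.1]
    have hle : mk (v.fst + ε / 2) 0 hpos (by linarith [h s hs, s.fst_mem.2]) (by simp) ≤ v :=
      hv.2 fun a ha => le_iff.2 (Or.inl (by rw [fst_mk]; linarith [h a ha]))
    have := fst_mono hle
    rw [fst_mk] at this
    linarith
  obtain ⟨s, hs, hsε⟩ := h1
  by_cases hd : v < d
  · obtain ⟨s', hs', -, hds'⟩ := hv.exists_between hd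
    rcases le_total s s' with h | h
    · exact ⟨s, hs, hsε, fun _ => h.trans_lt hds'⟩
    · exact ⟨s', hs', (fst_mono h).trans_lt hsε, fun _ => hds'⟩
  · exact ⟨s, hs, hsε, fun h => absurd h hd⟩

end TruthValue

/-! ### From a countable order with standard parts to truth values -/

open TruthValue

/-- A countable linear order with standard parts in `[0,1]` and elements standing for the rational
truth values maps monotonically to the truth values; the map is injective except that the elements
of standard part `0` all go to `0̂`, and it preserves every supremum and infimum that has the same
standard part as some element of the set. -/
theorem exists_map_truthValue {D : Type*} [LinearOrder D] [Countable D] (st : D → ℝ)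
    (hst : Monotone st) (hst01 : ∀ d, st d ∈ Set.Icc (0 : ℝ) 1) (c : RatUnit → D)
    (hc : ∀ r, st (c r) = r.1) (hc1 : ∀ d, d ≤ c oneRat) :
    ∃ h : D → TruthValue, Monotone h ∧ (∀ a b, a < b → h a = h b → h b = hat zeroRat) ∧
      (∀ r, h (c r) = hat r) ∧
      (∀ S : Set D, ∀ v, IsLUB S v → (∃ s ∈ S, st s = st v) → IsLUB (h '' S) (h v)) ∧
      (∀ S : Set D, ∀ v, IsGLB S v → (∃ s ∈ S, st s = st v) → IsGLB (h '' S) (h v)) := by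
  have hblock : ∀ t : ℝ, 0 < t → ∃ j : {d // st d = t} → ℝ, StrictMono j ∧
      (∀ d, j d ∈ Set.Icc (0 : ℝ) 1) ∧ (∀ r, ∀ h : st (c r) = t, j ⟨c r, h⟩ = t) ∧
      (∀ S : Set {d // st d = t}, ∀ d, S.Nonempty → IsLUB S d → IsLUB (j '' S) (j d)) ∧
      (∀ S : Set {d // st d = t}, ∀ d, S.Nonempty → IsGLB S d → IsGLB (j '' S) (j d)) := by
    intro t ht
    by_cases hne : ∃ d, st d = t
    · obtain ⟨d₀, hd₀⟩ := hne
      have ht1 : t ≤ 1 := hd₀ ▸ (hst01 d₀).2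
      -- A fibre contains at most one constant, which must get height `t`; without one, any base
      -- point will do.
      have hp : ∃ p : {d // st d = t}, ∀ r, st (c r) = t → c r = p := by
        by_cases hr : ∃ r, st (c r) = t
        · obtain ⟨r, hr⟩ := hr
          refine ⟨⟨c r, hr⟩, fun r' hr' => ?_⟩
          have : r' = r := Subtype.ext (by
            have h1 := (hc r').symm.trans (hr'.trans (hr.symm.trans (hc r)))
            exact_mod_cast h1)
          rw [this]
        · exact ⟨⟨d₀, hd₀⟩, fun r h => absurd ⟨r, h⟩ hr⟩
      obtain ⟨p, hp⟩ := hp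
      obtain ⟨j, hj, hj01, hjp, hsup, hinf⟩ := exists_strictMono_unitInterval ht ht1 p (by
        intro h1 d
        have := hp oneRat (by rw [hc, h1]; simp [oneRat])
        exact Subtype.coe_le_coe.1 (this ▸ hc1 d.1))
      refine ⟨j, hj, hj01, fun r hr => ?_, hsup, hinf⟩
      have : (⟨c r, hr⟩ : {d // st d = t}) = p := Subtype.ext (hp r hr)
      rw [this, hjp]
    · have hE : IsEmpty {d // st d = t} := ⟨fun d => hne ⟨d.1, d.2⟩⟩
      exact ⟨fun _ => 0, fun a => hE.elim a, fun d => hE.elim d, fun r h => absurd ⟨_, h⟩ hne,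
        fun _ d => hE.elim d, fun _ d => hE.elim d⟩
  choose j hj hj01 hjc hsup hinf using hblock
  have hpos : ∀ d, st d ≠ 0 → 0 < st d := fun d hd => lt_of_le_of_ne (hst01 d).1 hd.symm
  -- Over `0` there is no vertical segment: `0̂` is the only truth value with first coordinate `0`.
  let h : D → TruthValue := fun d =>
    if hd : st d = 0 then hat zeroRat
    else mk (st d) (j (st d) (hpos d hd) ⟨d, rfl⟩) (hpos d hd) (hst01 d).2 (hj01 _ _ _)
  have hfst : ∀ d, (h d).fst = st d := by
    intro d
    by_cases hd : st d = 0
    · simp [h, hd, zeroRat]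
    · simp [h, hd]
  have hsnd : ∀ t, ∀ ht : 0 < t, ∀ d, ∀ hd : st d = t, (h d).snd = j t ht ⟨d, hd⟩ := by
    rintro t ht d rfl
    simp [h, ht.ne']
  have hzero : ∀ d, st d = 0 → h d = hat zeroRat := fun d hd => by simp [h, hd]
  have hmono : Monotone h := by
    intro a b hab
    rcases (hst hab).lt_or_eq with hlt | heq
    · exact le_iff.2 (Or.inl (by rwa [hfst, hfst]))
    · by_cases hb : st b = 0
      · rw [hzero a (heq.trans hb), hzero b hb]
      · refine le_iff.2 (Or.inr ⟨by rw [hfst, hfst, heq], ?_⟩)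
        rw [hsnd _ (hpos b hb) a heq, hsnd _ (hpos b hb) b rfl]
        exact (hj _ _).monotone (Subtype.mk_le_mk.2 hab)
  refine ⟨h, hmono, fun a b hab heq => ?_, fun r => ?_, fun S v hv hs => ?_, fun S v hv hs => ?_⟩
  · by_contra hb
    have hb0 : st b ≠ 0 := fun h0 => hb (hzero b h0)
    have hab' : st a = st b := by rw [← hfst, heq, hfst]
    have h2 := hsnd _ (hpos b hb0) a hab'
    rw [heq, hsnd _ (hpos b hb0) b rfl] at h2
    exact hab.ne' (congrArg Subtype.val ((hj _ _).injective h2))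
  · by_cases hr : st (c r) = 0
    · rw [hzero _ hr]
      congr 1
      rw [hc] at hr
      exact Subtype.ext (by simpa [zeroRat] using (by exact_mod_cast hr.symm : (0 : ℚ) = r.1))
    · refine TruthValue.ext (by rw [hfst, hc, fst_hat]) ?_
      rw [hsnd _ (hpos _ hr) _ rfl, hjc, hc, snd_hat]
  · refine ⟨hmono.mem_upperBounds_image hv.1, fun u hu => ?_⟩
    obtain ⟨s₀, hs₀, hst₀⟩ := hs
    by_cases h0 : st v = 0
    · rw [hzero v h0]
      exact hat_zero_le u
    have hfu : st v ≤ u.fst := by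
      have := fst_mono (hu ⟨s₀, hs₀, rfl⟩)
      rwa [hfst, hst₀] at this
    rcases hfu.lt_or_eq with hlt | heq
    · exact le_iff.2 (Or.inl (by rwa [hfst]))
    refine le_iff.2 (Or.inr ⟨by rwa [hfst], ?_⟩)
    rw [hsnd _ (hpos v h0) v rfl]
    -- The part of `S` in the fibre of `v` still has supremum `v`: an element of `S` between a point
    -- of the fibre and `v` lies in the fibre.
    refine (hsup _ (hpos v h0) {d | d.1 ∈ S} ⟨v, rfl⟩ ⟨⟨s₀, hst₀⟩, hs₀⟩ ⟨?_, ?_⟩).2 ?_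
    · exact fun d hd => Subtype.mk_le_mk.2 (hv.1 hd)
    · intro d hd
      by_contra! hdv
      obtain ⟨s, hs, hds, hsv⟩ := hv.exists_between (Subtype.mk_lt_mk.1 hdv : d.1 < v)
      have hss : st s = st v := le_antisymm (hst hsv) (d.2 ▸ hst hds.le)
      exact absurd hds (not_lt.2 (Subtype.mk_le_mk.1 (hd (show (⟨s, hss⟩ : {d // st d = st v}) ∈
        {d : {d // st d = st v} | d.1 ∈ S} from hs))))
    · rintro _ ⟨d, hd, rfl⟩
      rcases le_iff.1 (hu ⟨d.1, hd, rfl⟩) with h1 | h1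
      · rw [hfst, d.2] at h1
        exact absurd heq h1.ne
      · rw [hsnd _ (hpos v h0) d.1 d.2] at h1
        exact h1.2
  · refine ⟨hmono.mem_lowerBounds_image hv.1, fun u hu => ?_⟩
    obtain ⟨s₀, hs₀, hst₀⟩ := hs
    by_cases h0 : st v = 0
    · rw [hzero v h0, ← hzero s₀ (hst₀.trans h0)]
      exact hu ⟨s₀, hs₀, rfl⟩
    have hfu : u.fst ≤ st v := by
      have := fst_mono (hu ⟨s₀, hs₀, rfl⟩)
      rwa [hfst, hst₀] at this
    rcases hfu.lt_or_eq with hlt | heq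
    · exact le_iff.2 (Or.inl (by rwa [hfst]))
    refine le_iff.2 (Or.inr ⟨by rwa [hfst], ?_⟩)
    rw [hsnd _ (hpos v h0) v rfl]
    refine (hinf _ (hpos v h0) {d | d.1 ∈ S} ⟨v, rfl⟩ ⟨⟨s₀, hst₀⟩, hs₀⟩ ⟨?_, ?_⟩).2 ?_
    · exact fun d hd => Subtype.mk_le_mk.2 (hv.1 hd)
    · intro d hd
      by_contra! hdv
      obtain ⟨s, hs, hsv, hds⟩ := hv.exists_between (Subtype.mk_lt_mk.1 hdv : v < d.1)
      have hss : st s = st v := le_antisymm (d.2 ▸ hst hds.le) (hst hsv)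
      exact absurd hds (not_lt.2 (Subtype.mk_le_mk.1 (hd (show (⟨s, hss⟩ : {d // st d = st v}) ∈
        {d : {d // st d = st v} | d.1 ∈ S} from hs))))
    · rintro _ ⟨d, hd, rfl⟩
      rcases le_iff.1 (hu ⟨d.1, hd, rfl⟩) with h1 | h1
      · rw [hfst, d.2] at h1
        exact absurd heq h1.ne
      · rw [hsnd _ (hpos v h0) d.1 d.2] at h1
        exact h1.2

/-! ### Countability -/

/-- For countably many operations of arity `ℕ` on a nonempty type there is a countable set
with a point `c` such that the set is closed under the operations at the sequences in the set that
are eventually `c`. -/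
theorem exists_countable_closed {C : Type*} [Nonempty C] {S : Type*} [Countable S]
    (op : S → (ℕ → C) → C) :
    ∃ N : Set C, N.Countable ∧ ∃ c ∈ N, ∀ s n, ∀ ρ : ℕ → C, (∀ k, ρ k ∈ N) →
      op s (fun k => if k < n then ρ k else c) ∈ N := by
  obtain ⟨c⟩ := ‹Nonempty C›
  -- Each operation becomes a function symbol of every finite arity, with `c` as padding, so the set
  -- is a substructure closure in a countable language.
  let K : FirstOrder.Language := ⟨fun _ => S, fun _ => Empty⟩
  let _ : K.Structure C :=
    { funMap := fun {n} s v => op s fun k => if h : k < n then v ⟨k, h⟩ else c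
      RelMap := fun r => r.elim }
  have : Countable (Σ n, K.Functions n) := inferInstanceAs (Countable (Σ _ : ℕ, S))
  have hN := (Set.countable_singleton c).substructure_closure K
  refine ⟨FirstOrder.Language.Substructure.closure K {c}, hN, c,
    FirstOrder.Language.Substructure.subset_closure rfl, fun s n ρ hρ => ?_⟩
  have heq : (fun k => if k < n then ρ k else c) =
      fun k => if h : k < n then (fun i : Fin n => ρ i) ⟨k, h⟩ else c := by
    funext k
    simp
  rw [heq]
  exact (FirstOrder.Language.Substructure.closure K {c}).fun_mem (n := n) s (fun i => ρ i)
    fun i => hρ i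

variable {L : FirstOrder.Language.{u, v}}

instance Formula.instNonempty : Nonempty (Formula L) := ⟨.const zeroRat⟩

/-- The formulas of a countable language form a countable set. -/
theorem Formula.countable [Countable (Σ n, L.Functions n)] [Countable (Σ n, L.Relations n)] :
    Countable (Formula L) := by
  have : ∀ n, Countable (L.Relations n) := fun n =>
    (sigma_mk_injective (i := n) : Function.Injective
      (Sigma.mk n : L.Relations n → Σ n, L.Relations n)).countable
  let S := RatUnit ⊕ (Σ n, L.Relations n × (Fin n → L.Term ℕ)) ⊕ Bool ⊕ (Bool × ℕ)
  let op : S → (ℕ → Formula L) → Formula L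
    | .inl r, _ => .const r
    | .inr (.inl a), _ => .atom a.2.1 a.2.2
    | .inr (.inr (.inl true)), ρ => .and (ρ 0) (ρ 1)
    | .inr (.inr (.inl false)), ρ => .imp (ρ 0) (ρ 1)
    | .inr (.inr (.inr (true, x))), ρ => .all x (ρ 0)
    | .inr (.inr (.inr (false, x))), ρ => .ex x (ρ 0)
  obtain ⟨N, hN, c, hc, hop⟩ := exists_countable_closed op
  have hall : ∀ φ, φ ∈ N := by
    intro φ
    induction φ with
    | const r => exact hop (.inl r) 0 (fun _ => c) fun _ => hc
    | atom P t => exact hop (.inr (.inl ⟨_, P, t⟩)) 0 (fun _ => c) fun _ => hc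
    | and φ ψ hφ hψ =>
      exact hop (.inr (.inr (.inl true))) 2 (fun k => if k = 0 then φ else ψ)
        fun k => by by_cases h : k = 0 <;> simp [h, hφ, hψ]
    | imp φ ψ hφ hψ =>
      exact hop (.inr (.inr (.inl false))) 2 (fun k => if k = 0 then φ else ψ)
        fun k => by by_cases h : k = 0 <;> simp [h, hφ, hψ]
    | all x φ hφ => exact hop (.inr (.inr (.inr (true, x)))) 1 (fun _ => φ) fun _ => hφ
    | ex x φ hφ => exact hop (.inr (.inr (.inr (false, x)))) 1 (fun _ => φ) fun _ => hφ
  exact Set.countable_univ_iff.1 (hN.mono fun φ _ => hall φ)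

/-! ### Dependence on finitely many variables -/

theorem exists_bound_termVal (t : L.Term ℕ) : ∃ b : ℕ, ∀ (M : Model.{u, v, w} L)
    (σ τ : ℕ → M.carrier), (∀ k < b, σ k = τ k) → M.termVal σ t = M.termVal τ t := by
  induction t with
  | var x => exact ⟨x + 1, fun M σ τ h => h x (Nat.lt_succ_self x)⟩
  | func f t ih =>
    choose b hb using ih
    refine ⟨Finset.univ.sup b, fun M σ τ h => ?_⟩
    simp only [Model.termVal]
    congr 1
    funext i
    exact hb i M σ τ fun k hk => h k (hk.trans_le (Finset.le_sup (Finset.mem_univ i)))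

/-- The bound is uniform in the structure, so one truncation of an assignment works in all
coordinates of the ultraproduct at once. -/
theorem exists_bound_val (φ : Formula L) : ∃ b : ℕ, ∀ (M : Model.{u, v, w} L)
    (σ τ : ℕ → M.carrier), (∀ k < b, σ k = τ k) → M.val φ σ = M.val φ τ := by
  have hupd : ∀ {C : Type w} {σ τ : ℕ → C} {b : ℕ} (x : ℕ) (a : C), (∀ k < b, σ k = τ k) →
      ∀ k < b, Function.update σ x a k = Function.update τ x a k := by
    intro C σ τ b x a h k hk
    by_cases hx : k = x
    · subst hx
      simp
    · simp [hx, h k hk]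
  induction φ with
  | const r => exact ⟨0, fun _ _ _ _ => rfl⟩
  | atom P t =>
    choose b hb using fun i => exists_bound_termVal.{u, v, w} (t i)
    refine ⟨Finset.univ.sup b, fun M σ τ h => ?_⟩
    simp only [Model.val]
    congr 1
    funext i
    exact hb i M σ τ fun k hk => h k (hk.trans_le (Finset.le_sup (Finset.mem_univ i)))
  | and φ ψ hφ hψ =>
    obtain ⟨b, hb⟩ := hφ
    obtain ⟨c, hc⟩ := hψ
    refine ⟨max b c, fun M σ τ h => ?_⟩
    simp only [Model.val]
    rw [hb M σ τ fun k hk => h k (lt_max_of_lt_left hk),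
      hc M σ τ fun k hk => h k (lt_max_of_lt_right hk)]
  | imp φ ψ hφ hψ =>
    obtain ⟨b, hb⟩ := hφ
    obtain ⟨c, hc⟩ := hψ
    refine ⟨max b c, fun M σ τ h => ?_⟩
    simp only [Model.val]
    rw [hb M σ τ fun k hk => h k (lt_max_of_lt_left hk),
      hc M σ τ fun k hk => h k (lt_max_of_lt_right hk)]
  | all x φ hφ =>
    obtain ⟨b, hb⟩ := hφ
    refine ⟨b, fun M σ τ h => ?_⟩
    simp only [Model.val]
    congr 2
    funext a
    exact hb M _ _ (hupd x a h)
  | ex x φ hφ =>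
    obtain ⟨b, hb⟩ := hφ
    refine ⟨b, fun M σ τ h => ?_⟩
    simp only [Model.val]
    congr 2
    funext a
    exact hb M _ _ (hupd x a h)

/-! ### Ultraproducts -/

/-- The ultrapower of the set of truth values. -/
abbrev UltraValue : Type := Germ (hyperfilter ℕ : Filter ℕ) TruthValue

/-- Every element of the ultrapower has a standard part for its first coordinate. -/
theorem exists_standardPart : ∃ st : UltraValue → ℝ, ∀ f : ℕ → TruthValue,
    Tendsto (fun n => (f n).fst) (hyperfilter ℕ) (𝓝 (st (f : UltraValue))) := by
  have key : ∀ g : UltraValue, ∃ t : ℝ, ∀ f : ℕ → TruthValue, (f : UltraValue) = g →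
      Tendsto (fun n => (f n).fst) (hyperfilter ℕ) (𝓝 t) := by
    intro g
    induction g using Germ.inductionOn with | h f => ?_
    obtain ⟨t, -, ht⟩ := (isCompact_Icc : IsCompact (Set.Icc (0 : ℝ) 1)).ultrafilter_le_nhds
      ((hyperfilter ℕ).map fun n : ℕ => (f n).fst)
      (le_principal_iff.2 (mem_map.2 (Eventually.of_forall fun n => (f n).fst_mem)))
    refine ⟨t, fun f' hf' => Tendsto.congr' ?_ (ht : Tendsto (fun n : ℕ => (f n).fst) _ _)⟩
    filter_upwards [Germ.coe_eq.1 hf'] with n hn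
    rw [hn]
  choose st hst using key
  exact ⟨st, fun f => hst _ f rfl⟩

section Ultraproduct

variable (M : ℕ → Model.{u, v, w} L)

/-- The value of a formula in the ultraproduct of the structures `M n`. -/
noncomputable def ultraVal (φ : Formula L) (σ : ℕ → ∀ n, (M n).carrier) : UltraValue :=
  ((fun n => (M n).val φ fun x => σ x n : ℕ → TruthValue) : UltraValue)

variable {M}

theorem update_apply_apply (σ : ℕ → ∀ n, (M n).carrier) (x : ℕ) (a : ∀ n, (M n).carrier) (n : ℕ) :
    (fun k => Function.update σ x a k n) = Function.update (fun k => σ k n) x (a n) := by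
  funext k
  by_cases h : k = x
  · subst h
    simp
  · simp [h]

theorem ultraVal_congr {φ : Formula L} {b : ℕ}
    (hb : ∀ (M : Model.{u, v, w} L) (σ τ : ℕ → M.carrier), (∀ k < b, σ k = τ k) →
      M.val φ σ = M.val φ τ)
    {σ τ : ℕ → ∀ n, (M n).carrier} (h : ∀ k < b, σ k = τ k) : ultraVal M φ σ = ultraVal M φ τ := by
  unfold ultraVal
  congr 1
  funext n
  exact hb _ _ _ fun k hk => by rw [h k hk]

theorem ultraVal_le_all (φ : Formula L) (x : ℕ) (σ : ℕ → ∀ n, (M n).carrier)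
    (a : ∀ n, (M n).carrier) : ultraVal M φ (Function.update σ x a) ≤ ultraVal M (.all x φ) σ := by
  refine Germ.coe_le.2 (Eventually.of_forall fun n => ?_)
  simp only [update_apply_apply]
  exact (TruthValue.isLUB_sup _).1 ⟨a n, rfl⟩

theorem ex_le_ultraVal (φ : Formula L) (x : ℕ) (σ : ℕ → ∀ n, (M n).carrier)
    (a : ∀ n, (M n).carrier) : ultraVal M (.ex x φ) σ ≤ ultraVal M φ (Function.update σ x a) := by
  refine Germ.coe_le.2 (Eventually.of_forall fun n => ?_)
  simp only [update_apply_apply]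
  exact (TruthValue.isGLB_inf _).1 ⟨a n, rfl⟩

theorem tendsto_one_div_hyperfilter :
    Tendsto (fun n : ℕ => 1 / ((n : ℝ) + 1)) (hyperfilter ℕ) (𝓝 0) :=
  tendsto_one_div_add_atTop_nhds_zero_nat.mono_left Nat.hyperfilter_le_atTop

section StandardPart

variable {st : UltraValue → ℝ} (hst : ∀ f : ℕ → TruthValue,
    Tendsto (fun n => (f n).fst) (hyperfilter ℕ) (𝓝 (st (f : UltraValue))))
include hst

theorem standardPart_mono : Monotone st := by
  intro a b
  induction a using Germ.inductionOn with | h f => ?_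
  induction b using Germ.inductionOn with | h g => ?_
  intro h
  exact le_of_tendsto_of_tendsto (hst f) (hst g)
    ((Germ.coe_le.1 h).mono fun n hn => TruthValue.fst_mono hn)

theorem standardPart_mem (a : UltraValue) : st a ∈ Set.Icc (0 : ℝ) 1 := by
  induction a using Germ.inductionOn with | h f => ?_
  exact isClosed_Icc.mem_of_tendsto (hst f) (Eventually.of_forall fun n => (f n).fst_mem)

theorem standardPart_const (r : RatUnit) (σ : ℕ → ∀ n, (M n).carrier) :
    st (ultraVal M (.const r) σ) = r.1 :=
  tendsto_nhds_unique (hst _) tendsto_const_nhds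

/-- In coordinate `n` an element is chosen within `1/(n+1)` of the supremum in first coordinate, and
above the value of `ψ` if the supremum is. The error vanishes along the ultrafilter. -/
theorem exists_witness_all (φ : Formula L) (x : ℕ) (ψ : Formula L)
    (σ τ : ℕ → ∀ n, (M n).carrier) : ∃ a : ∀ n, (M n).carrier,
      st (ultraVal M φ (Function.update σ x a)) = st (ultraVal M (.all x φ) σ) ∧
      (ultraVal M ψ τ < ultraVal M (.all x φ) σ →
        ultraVal M ψ τ < ultraVal M φ (Function.update σ x a)) := by
  have key : ∀ n, ∃ a : (M n).carrier,
      ((M n).val (.all x φ) fun k => σ k n).fst - 1 / ((n : ℝ) + 1) <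
        ((M n).val φ (Function.update (fun k => σ k n) x a)).fst ∧
      (((M n).val ψ fun k => τ k n) < ((M n).val (.all x φ) fun k => σ k n) →
        ((M n).val ψ fun k => τ k n) < (M n).val φ (Function.update (fun k => σ k n) x a)) := by
    intro n
    have := (M n).nonempty
    obtain ⟨_, ⟨a, rfl⟩, ha⟩ := TruthValue.exists_mem_near_isLUB (Set.range_nonempty _)
      (TruthValue.isLUB_sup (Set.range fun a => (M n).val φ (Function.update (fun k => σ k n) x a)))
      (Nat.one_div_pos_of_nat (α := ℝ) (n := n)) ((M n).val ψ fun k => τ k n)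
    exact ⟨a, ha⟩
  choose a ha1 ha2 using key
  refine ⟨a, le_antisymm (standardPart_mono hst (ultraVal_le_all φ x σ a)) ?_, fun h => ?_⟩
  · have h1 := (hst fun n => (M n).val (.all x φ) fun k => σ k n).sub tendsto_one_div_hyperfilter
    rw [sub_zero] at h1
    refine le_of_tendsto_of_tendsto h1 (hst _) (Eventually.of_forall fun n => ?_)
    simp only [update_apply_apply]
    exact (ha1 n).le
  · refine Germ.coe_lt.2 ((Germ.coe_lt.1 h).mono fun n hn => ?_)
    simp only [update_apply_apply]
    exact ha2 n hn

theorem exists_witness_ex (φ : Formula L) (x : ℕ) (ψ : Formula L)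
    (σ τ : ℕ → ∀ n, (M n).carrier) : ∃ a : ∀ n, (M n).carrier,
      st (ultraVal M φ (Function.update σ x a)) = st (ultraVal M (.ex x φ) σ) ∧
      (ultraVal M (.ex x φ) σ < ultraVal M ψ τ →
        ultraVal M φ (Function.update σ x a) < ultraVal M ψ τ) := by
  have key : ∀ n, ∃ a : (M n).carrier,
      ((M n).val φ (Function.update (fun k => σ k n) x a)).fst <
        ((M n).val (.ex x φ) fun k => σ k n).fst + 1 / ((n : ℝ) + 1) ∧
      (((M n).val (.ex x φ) fun k => σ k n) < ((M n).val ψ fun k => τ k n) →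
        (M n).val φ (Function.update (fun k => σ k n) x a) < ((M n).val ψ fun k => τ k n)) := by
    intro n
    have := (M n).nonempty
    obtain ⟨_, ⟨a, rfl⟩, ha⟩ := TruthValue.exists_mem_near_isGLB (Set.range_nonempty _)
      (TruthValue.isGLB_inf (Set.range fun a => (M n).val φ (Function.update (fun k => σ k n) x a)))
      (Nat.one_div_pos_of_nat (α := ℝ) (n := n)) ((M n).val ψ fun k => τ k n)
    exact ⟨a, ha⟩
  choose a ha1 ha2 using key
  refine ⟨a, le_antisymm ?_ (standardPart_mono hst (ex_le_ultraVal φ x σ a)), fun h => ?_⟩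
  · have h1 := (hst fun n => (M n).val (.ex x φ) fun k => σ k n).add tendsto_one_div_hyperfilter
    rw [add_zero] at h1
    refine le_of_tendsto_of_tendsto (hst _) h1 (Eventually.of_forall fun n => ?_)
    simp only [update_apply_apply]
    exact (ha1 n).le
  · refine Germ.coe_lt.2 ((Germ.coe_lt.1 h).mono fun n hn => ?_)
    simp only [update_apply_apply]
    exact ha2 n hn

end StandardPart

end Ultraproduct

/-! ### The countable part of the ultraproduct and its truth values -/

theorem coe_update {C : Type*} {N : Set C} (σ : ℕ → N) (x : ℕ) (a : N) :
    (fun k => (Function.update σ x a k).1) = Function.update (fun k => (σ k).1) x a.1 := by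
  funext k
  by_cases h : k = x
  · subst h
    simp
  · simp [h]

/-- A countable nonempty part of the product of the `M n` that is closed under the functions and
contains witnesses for all quantifiers. -/
theorem exists_countable_witnesses [Countable (Σ n, L.Functions n)] [Countable (Formula L)]
    (M : ℕ → Model.{u, v, w} L) {st : UltraValue → ℝ}
    (hst : ∀ f : ℕ → TruthValue,
      Tendsto (fun n => (f n).fst) (hyperfilter ℕ) (𝓝 (st (f : UltraValue)))) :
    ∃ N : Set (∀ n, (M n).carrier), N.Countable ∧ N.Nonempty ∧
      (∀ {m} (f : L.Functions m) (v : Fin m → N),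
        (fun n => (M n).funMap f fun i => (v i).1 n) ∈ N) ∧
      (∀ (φ : Formula L) (x : ℕ) (ψ : Formula L) (σ τ : ℕ → N), ∃ a : N,
        st (ultraVal M φ (fun k => (Function.update σ x a k).1)) =
          st (ultraVal M (.all x φ) fun k => (σ k).1) ∧
        (ultraVal M ψ (fun k => (τ k).1) < ultraVal M (.all x φ) (fun k => (σ k).1) →
          ultraVal M ψ (fun k => (τ k).1) <
            ultraVal M φ fun k => (Function.update σ x a k).1)) ∧
      (∀ (φ : Formula L) (x : ℕ) (ψ : Formula L) (σ τ : ℕ → N), ∃ a : N,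
        st (ultraVal M φ (fun k => (Function.update σ x a k).1)) =
          st (ultraVal M (.ex x φ) fun k => (σ k).1) ∧
        (ultraVal M (.ex x φ) (fun k => (σ k).1) < ultraVal M ψ (fun k => (τ k).1) →
          ultraVal M φ (fun k => (Function.update σ x a k).1) <
            ultraVal M ψ fun k => (τ k).1)) := by
  have hne : ∀ n, Nonempty (M n).carrier := fun n => (M n).nonempty
  choose wAll hAll using exists_witness_all (M := M) hst
  choose wEx hEx using exists_witness_ex (M := M) hst
  let op : (Σ m, L.Functions m) ⊕ (Bool × Formula L × ℕ × Formula L) →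
      (ℕ → ∀ n, (M n).carrier) → ∀ n, (M n).carrier
    | .inl f, ρ => fun n => (M n).funMap f.2 fun i => ρ i n
    -- One sequence encodes both assignments, `σ` at even and `τ` at odd places.
    | .inr (true, φ, x, ψ), ρ => wAll φ x ψ (fun k => ρ (2 * k)) (fun k => ρ (2 * k + 1))
    | .inr (false, φ, x, ψ), ρ => wEx φ x ψ (fun k => ρ (2 * k)) (fun k => ρ (2 * k + 1))
  obtain ⟨N, hN, c, hc, hop⟩ := exists_countable_closed op
  have hbound : ∀ (φ : Formula L) (x : ℕ) (ψ : Formula L) (σ τ : ℕ → N), ∃ (n : ℕ) (ρ : ℕ → N),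
      (∀ a, ultraVal M φ (Function.update
        (fun k => if 2 * k < n then (ρ (2 * k)).1 else c) x a) =
          ultraVal M φ (Function.update (fun k => (σ k).1) x a)) ∧
      ultraVal M (.all x φ) (fun k => if 2 * k < n then (ρ (2 * k)).1 else c) =
        ultraVal M (.all x φ) (fun k => (σ k).1) ∧
      ultraVal M (.ex x φ) (fun k => if 2 * k < n then (ρ (2 * k)).1 else c) =
        ultraVal M (.ex x φ) (fun k => (σ k).1) ∧
      ultraVal M ψ (fun k => if 2 * k + 1 < n then (ρ (2 * k + 1)).1 else c) =
        ultraVal M ψ (fun k => (τ k).1) := by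
    intro φ x ψ σ τ
    obtain ⟨b₁, hb₁⟩ := exists_bound_val.{u, v, w} φ
    obtain ⟨b₂, hb₂⟩ := exists_bound_val.{u, v, w} (.all x φ)
    obtain ⟨b₃, hb₃⟩ := exists_bound_val.{u, v, w} (.ex x φ)
    obtain ⟨b₄, hb₄⟩ := exists_bound_val.{u, v, w} ψ
    let ρ : ℕ → N := fun k => if k % 2 = 0 then σ (k / 2) else τ (k / 2)
    have h0 : ∀ k, ρ (2 * k) = σ k := fun k => by simp [ρ]
    have h1 : ∀ k, ρ (2 * k + 1) = τ k := fun k => by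
      have e1 : (2 * k + 1) % 2 = 1 := by omega
      have e2 : (2 * k + 1) / 2 = k := by omega
      simp [ρ, e1, e2]
    -- Closure is known only for sequences that are eventually `c`; cutting at twice the sum of the
    -- bounds keeps every even and odd place that matters.
    refine ⟨2 * (b₁ + b₂ + b₃ + b₄), ρ, fun a => ultraVal_congr hb₁ fun k hk => ?_,
      ultraVal_congr hb₂ fun k hk => ?_, ultraVal_congr hb₃ fun k hk => ?_,
      ultraVal_congr hb₄ fun k hk => ?_⟩
    · by_cases h : k = x
      · subst h
        simp
      · rw [Function.update_of_ne h, Function.update_of_ne h, if_pos (by omega), h0]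
    · rw [if_pos (by omega), h0]
    · rw [if_pos (by omega), h0]
    · rw [if_pos (by omega), h1]
  refine ⟨N, hN, ⟨c, hc⟩, fun {m} f v => ?_, fun φ x ψ σ τ => ?_, fun φ x ψ σ τ => ?_⟩
  · have := hop (.inl ⟨m, f⟩) m (fun k => if h : k < m then (v ⟨k, h⟩).1 else c) fun k => by
      by_cases h : k < m <;> simp [h, hc]
    simpa [op] using this
  · obtain ⟨n, ρ, e1, e2, -, e4⟩ := hbound φ x ψ σ τ
    have hm := hop (.inr (true, φ, x, ψ)) n (fun k => (ρ k).1) fun k => (ρ k).2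
    have hw := hAll φ x ψ (fun k => if 2 * k < n then (ρ (2 * k)).1 else c)
      (fun k => if 2 * k + 1 < n then (ρ (2 * k + 1)).1 else c)
    rw [e1, e2, e4] at hw
    refine ⟨⟨_, hm⟩, ?_⟩
    rw [coe_update]
    exact hw
  · obtain ⟨n, ρ, e1, -, e3, e4⟩ := hbound φ x ψ σ τ
    have hm := hop (.inr (false, φ, x, ψ)) n (fun k => (ρ k).1) fun k => (ρ k).2
    have hw := hEx φ x ψ (fun k => if 2 * k < n then (ρ (2 * k)).1 else c)
      (fun k => if 2 * k + 1 < n then (ρ (2 * k + 1)).1 else c)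
    rw [e1, e3, e4] at hw
    refine ⟨⟨_, hm⟩, ?_⟩
    rw [coe_update]
    exact hw

/-- Given countably many structures, some structure satisfies every sentence that holds in all but
finitely many of them. -/
theorem exists_model_of_eventually [Countable (Σ n, L.Functions n)] [Countable (Formula L)]
    (M : ℕ → Model.{u, v, w} L) : ∃ A : Model.{u, v, w} L, ∀ φ : Sentence L,
      (∀ᶠ n in atTop, (M n).Satisfies φ) → A.Satisfies φ := by
  obtain ⟨st, hst⟩ := exists_standardPart
  obtain ⟨N, hN, ⟨c₀, hc₀⟩, hfun, hAll, hEx⟩ := exists_countable_witnesses M hst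
  have : Countable N := hN
  let D := {g : UltraValue // ∃ (φ : Formula L) (σ : ℕ → N), ultraVal M φ (fun k => (σ k).1) = g}
  have hD : Countable D := by
    -- Finite tuples padded with `c₀` already produce all values.
    let F : Formula L × (Σ n : ℕ, Fin n → N) → UltraValue := fun p =>
      ultraVal M p.1 fun k => if h : k < p.2.1 then (p.2.2 ⟨k, h⟩).1 else c₀
    refine ((Set.countable_range F).mono ?_ : Set.Countable
      {g | ∃ (φ : Formula L) (σ : ℕ → N), ultraVal M φ (fun k => (σ k).1) = g})
    rintro _ ⟨φ, σ, rfl⟩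
    obtain ⟨b, hb⟩ := exists_bound_val.{u, v, w} φ
    exact ⟨(φ, ⟨b, fun i => σ i⟩), ultraVal_congr hb fun k hk => by simp [hk]⟩
  let dval : Formula L → (ℕ → N) → D := fun φ σ => ⟨ultraVal M φ fun k => (σ k).1, φ, σ, rfl⟩
  obtain ⟨h, hmono, hinj, hconst, hsup, hinf⟩ := exists_map_truthValue (fun d : D => st d.1)
    (fun _ _ hab => standardPart_mono hst hab) (fun d => standardPart_mem hst d.1)
    (fun r => dval (.const r) fun _ => ⟨c₀, hc₀⟩) (fun r => standardPart_const hst r _)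
    (by
      rintro ⟨_, φ, σ, rfl⟩
      exact Subtype.mk_le_mk.2 (Germ.coe_le.2
        (Eventually.of_forall fun n => TruthValue.le_hat_one _)))
  classical
  -- The default is harmless: `hval` evaluates `pred` only at values of atomic formulas.
  let pred : UltraValue → TruthValue := fun g =>
    if hg : ∃ (φ : Formula L) (σ : ℕ → N), ultraVal M φ (fun k => (σ k).1) = g then h ⟨g, hg⟩
    else hat zeroRat
  have hpred : ∀ φ σ, pred (ultraVal M φ fun k => (σ k).1) = h (dval φ σ) := fun φ σ =>
    dif_pos ⟨φ, σ, rfl⟩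
  let A : Model.{u, v, w} L :=
    { carrier := N
      nonempty := ⟨⟨c₀, hc₀⟩⟩
      funMap := fun f v => ⟨_, hfun f v⟩
      predMap := fun P v =>
        pred ((fun n => (M n).predMap P fun i => (v i).1 n : ℕ → TruthValue) : UltraValue) }
  have hterm : ∀ (t : L.Term ℕ) (σ : ℕ → N) (n : ℕ),
      (show N from A.termVal σ t).1 n = (M n).termVal (fun k => (σ k).1 n) t := by
    intro t σ n
    induction t with
    | var x => rfl
    | func f t ih =>
      change (M n).funMap f (fun i => (show N from A.termVal σ (t i)).1 n) = _
      simp only [Model.termVal]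
      congr 1
      funext i
      exact ih i
  have hval : ∀ (φ : Formula L) (σ : ℕ → N), A.val φ σ = h (dval φ σ) := by
    intro φ
    induction φ with
    | const r => exact fun σ => (hconst r).symm
    | atom P t =>
      intro σ
      rw [← hpred]
      change pred _ = pred _
      congr 1
      unfold ultraVal
      congr 1
      funext n
      simp only [Model.val]
      congr 1
      funext i
      exact hterm (t i) σ n
    | and φ ψ hφ hψ =>
      intro σ
      have hmax : dval (.and φ ψ) σ = max (dval φ σ) (dval ψ σ) := by
        refine Subtype.ext ?_
        have : (max (dval φ σ) (dval ψ σ)).1 = max (dval φ σ).1 (dval ψ σ).1 :=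
          (Subtype.mono_coe _).map_max
        rw [this, Germ.max_def]
        rfl
      rw [hmax, hmono.map_max, ← hφ, ← hψ]
      rfl
    | imp φ ψ hφ hψ =>
      intro σ
      simp only [Model.val, TruthValue.imp]
      rw [hφ, hψ]
      rcases le_or_gt (dval ψ σ) (dval φ σ) with hle | hlt
      · rw [if_pos (hmono hle), ← hconst]
        congr 1
        refine Subtype.ext (Germ.coe_eq.2 ?_)
        filter_upwards [Germ.coe_le.1 (Subtype.mk_le_mk.1 hle)] with n hn
        exact (if_pos hn).symm
      · have heq : dval (.imp φ ψ) σ = dval ψ σ := by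
          refine Subtype.ext (Germ.coe_eq.2 ?_)
          filter_upwards [Germ.coe_lt.1 (Subtype.mk_lt_mk.1 hlt)] with n hn
          exact if_neg (not_le.2 hn)
        rw [heq]
        -- If `h` merges the two values, the merged value is `0̂`, which is also the value of the
        -- implication.
        split_ifs with hc
        · exact (hinj _ _ hlt (le_antisymm (hmono hlt.le) hc)).symm
        · rfl
    | all x φ hφ =>
      intro σ
      have hlub : IsLUB (Set.range fun a => dval φ (Function.update σ x a)) (dval (.all x φ) σ) := by
        constructor
        · rintro _ ⟨a, rfl⟩
          refine Subtype.mk_le_mk.2 ?_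
          rw [coe_update]
          exact ultraVal_le_all φ x _ _
        -- Every element of `D` is the value of some formula `ψ`, so the witness against `ψ`
        -- excludes it as a smaller upper bound.
        · rintro ⟨_, ψ, τ, rfl⟩ hd
          by_contra hle
          have hlt := not_le.1 hle
          obtain ⟨a, -, ha⟩ := hAll φ x ψ σ τ
          exact absurd (Subtype.mk_le_mk.1 (hd ⟨a, rfl⟩)) (not_le.2 (ha (Subtype.mk_lt_mk.1 hlt)))
      have := hsup _ _ hlub (by
        obtain ⟨a, ha, -⟩ := hAll φ x φ σ σ
        exact ⟨_, ⟨a, rfl⟩, ha⟩)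
      rw [← Set.range_comp] at this
      have heq : (h ∘ fun a => dval φ (Function.update σ x a)) =
          fun a : A.carrier => A.val φ (Function.update σ x a) := funext fun a => (hφ _).symm
      rw [heq] at this
      exact (TruthValue.isLUB_sup _).unique this
    | ex x φ hφ =>
      intro σ
      have hglb : IsGLB (Set.range fun a => dval φ (Function.update σ x a)) (dval (.ex x φ) σ) := by
        constructor
        · rintro _ ⟨a, rfl⟩
          refine Subtype.mk_le_mk.2 ?_
          rw [coe_update]
          exact ex_le_ultraVal φ x _ _
        · rintro ⟨_, ψ, τ, rfl⟩ hd
          by_contra hle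
          have hlt := not_le.1 hle
          obtain ⟨a, -, ha⟩ := hEx φ x ψ σ τ
          exact absurd (Subtype.mk_le_mk.1 (hd ⟨a, rfl⟩)) (not_le.2 (ha (Subtype.mk_lt_mk.1 hlt)))
      have := hinf _ _ hglb (by
        obtain ⟨a, ha, -⟩ := hEx φ x φ σ σ
        exact ⟨_, ⟨a, rfl⟩, ha⟩)
      rw [← Set.range_comp] at this
      have heq : (h ∘ fun a => dval φ (Function.update σ x a)) =
          fun a : A.carrier => A.val φ (Function.update σ x a) := funext fun a => (hφ _).symm
      rw [heq] at this
      exact (TruthValue.isGLB_inf _).unique this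
  refine ⟨A, fun φ hφ σ => (hval φ.1 σ).trans ?_⟩
  rw [← hconst]
  congr 1
  refine Subtype.ext (Germ.coe_eq.2 ?_)
  filter_upwards [Nat.hyperfilter_le_atTop hφ] with n hn
  exact hn _

end RGL

theorem mainTheorem5 {L : FirstOrder.Language.{u, v}} (hL : Countable L.Symbols)
    (T : RGL.Theory L) (hT : RGL.Theory.FinitelySatisfiable.{u, v, w} T) :
    RGL.Theory.Satisfiable.{u, v, w} T := by
  have hF : Countable (Σ n, L.Functions n) := Sum.inl_injective.countable (β := L.Symbols)
  have hR : Countable (Σ n, L.Relations n) := Sum.inr_injective.countable (β := L.Symbols)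
  have hφ : Countable (RGL.Formula L) := RGL.Formula.countable
  obtain ⟨f, hf⟩ := exists_injective_nat (RGL.Sentence L)
  have hfin : ∀ n, {φ ∈ T | f φ ≤ n}.Finite := fun n =>
    ((Set.finite_Iic n).preimage hf.injOn).subset fun φ hφ => hφ.2
  -- Each sentence of `T` holds in `M n` from its own index onwards.
  choose M hM using fun n => hT _ (Set.sep_subset T fun φ => f φ ≤ n) (hfin n)
  obtain ⟨A, hA⟩ := RGL.exists_model_of_eventually M
  refine ⟨A, fun φ hφ => hA φ ?_⟩
  filter_upwards [Filter.eventually_ge_atTop (f φ)] with n hn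
  exact hM n φ ⟨hφ, hn⟩
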